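/- For a nonempty integer partition $\pi$ let $s(\pi)$ denote its smallest part. Let $spt(n)$ be Andrews' smallest parts function, i.e. the total number of occurrences of the smallest part, $\sum_{\pi} \#\{\text{parts of } \pi \text{ equal to } s(\pi)\}$, summed over all partitions $\pi$ of $n$. Let $spt_o^{+}(n)$ be the same sum restricted to those partitions $\pi$ of $n$ in which no odd part greater than $2s(\pi)$ occurs. (The empty partition contributes $0$ to both sums.) Then for every integer $n\ge 0$, $$spt_o^{+}(2n)\equiv spt(n)\pmod 2.$$ -/

import Mathlib

/-- The smallest part `s(π)` of a partition `π` (with value `0` for the empty partition). -/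
noncomputable def smallestPart {n : ℕ} (π : n.Partition) : ℕ :=
  sInf {i : ℕ | i ∈ π.parts}

/-- The number of occurrences of the smallest part in a partition
(this is `0` for the empty partition, which has no parts). -/
noncomputable def smallestPartCount {n : ℕ} (π : n.Partition) : ℕ :=
  π.parts.count (smallestPart π)

/-- Andrews' function `spt(n)`: the total number of smallest parts among all partitions of `n`. -/
noncomputable def spt (n : ℕ) : ℕ :=
  ∑ π : n.Partition, smallestPartCount π

/-- Odd parts greater than twice the smallest part do not occur in `π`. -/
def NoLargeOddParts {n : ℕ} (π : n.Partition) : Prop :=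
  ∀ i ∈ π.parts, Odd i → ¬ 2 * smallestPart π < i

open Classical in
/-- The function `spt_o^+(n)`: the total number of smallest parts among the partitions `π` of `n`
in which odd parts greater than twice the smallest part of `π` do not occur. -/
noncomputable def sptOPlus (n : ℕ) : ℕ :=
  ∑ π : n.Partition with NoLargeOddParts π, smallestPartCount π

/-!
Partitions with smallest part `s`, weighted by the multiplicity of `s`, have the generating function
`q ^ s / (1 - q ^ s) ^ 2` divided by the product of `1 - q ^ i` over the other admissible parts `i`.
Up to the factor `1 / (q ^ 2; q ^ 2)_∞`, this turns the generating functions of `sptOPlus` in `q`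
and of `spt` in `q ^ 2` into the sums that Bailey's lemma, differentiated twice, attaches to two
Bailey pairs in bases `q` and `q ^ 2`. Both pairs are built from the same signed powers of `q ^ 2`
with pentagonal exponents, which sit on the even indices in base `q` and on all indices in
base `q ^ 2`. Hence everything cancels in the difference of the two sums except the sum over odd `k`
of `q ^ k / (1 - q ^ k) ^ 2`. Modulo `2` squares are power series in `q ^ 2`, so this remainder has
only odd exponents, also after division by `(q ^ 2; q ^ 2)_∞`.

To avoid infinite products and sums, all parts are bounded and the identities hold modulo a power
of `q`.
-/

section FiniteSums

open Finset

lemma sum_range_succ_eq_add_sum_Icc {M : Type*} [AddCommMonoid M] (f : ℕ → M) (N : ℕ) :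
    ∑ r ∈ range (N + 1), f r = f 0 + ∑ r ∈ Icc 1 N, f r :=
  sum_range_eq_add_Ico f N.succ_pos

lemma sum_Icc_one_two_mul {M : Type*} [AddCommMonoid M] (f : ℕ → M) (N : ℕ) :
    ∑ n ∈ Icc 1 (2 * N), f n = ∑ k ∈ range N, f (2 * k + 1) + ∑ k ∈ Icc 1 N, f (2 * k) := by
  induction N with
  | zero => simp
  | succ N ih =>
    have hN : 2 * (N + 1) = 2 * N + 1 + 1 := by ring
    rw [sum_range_succ, sum_Icc_succ_top (show 1 ≤ N + 1 by omega), hN,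
      sum_Icc_succ_top (by omega), sum_Icc_succ_top (by omega), ih]
    ac_rfl

lemma extend_two_mul_zero {A : Type*} [Zero A] (α : ℕ → A) :
    Function.extend (2 * ·) α 0 0 = α 0 :=
  (mul_right_injective₀ two_ne_zero).extend_apply α 0 0

lemma sum_Icc_extend_two_mul {A : Type*} [NonUnitalNonAssocSemiring A] (α f : ℕ → A) (N : ℕ) :
    ∑ r ∈ Icc 1 (2 * N), Function.extend (2 * ·) α 0 r * f r =
      ∑ k ∈ Icc 1 N, α k * f (2 * k) := by
  have hodd (k : ℕ) : Function.extend (2 * ·) α 0 (2 * k + 1) = 0 :=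
    Function.extend_apply' _ _ _ fun ⟨j, hj⟩ ↦ by
      have : 2 * j = 2 * k + 1 := hj
      omega
  have heven (k : ℕ) : Function.extend (2 * ·) α 0 (2 * k) = α k :=
    (mul_right_injective₀ two_ne_zero).extend_apply α 0 k
  simp only [sum_Icc_one_two_mul, hodd, heven, zero_mul, sum_const_zero, zero_add]

lemma sum_range_extend_two_mul {A : Type*} [NonUnitalNonAssocSemiring A] (α f : ℕ → A) (N : ℕ) :
    ∑ r ∈ range (2 * N + 1), Function.extend (2 * ·) α 0 r * f r =
      ∑ k ∈ range (N + 1), α k * f (2 * k) := by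
  rw [sum_range_succ_eq_add_sum_Icc, sum_range_succ_eq_add_sum_Icc, sum_Icc_extend_two_mul,
    extend_two_mul_zero, mul_zero]

end FiniteSums

section QSeries

open Finset
open scoped Ring

variable {A : Type*} [CommRing A]

/-- The `q`-Pochhammer symbol `(a; q)_n = (1 - a) (1 - a q) ⋯ (1 - a q ^ (n - 1))`. -/
def qPochhammer (a q : A) (n : ℕ) : A := ∏ i ∈ range n, (1 - a * q ^ i)

/-- The condition on a base `q` under which every division by a power of some `1 - q ^ k` makes
sense; over a field it says that `q` is not a root of unity. -/
def IsRegularBase (q : A) : Prop := ∀ k ≠ 0, IsUnit (1 - q ^ k)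

/-- The term `q ^ n / (1 - q ^ n) ^ 2` of the Lambert series of the sum-of-divisors function.
Division is by `Ring.inverse`, so this is meaningful only if `1 - q ^ n` is a unit. -/
noncomputable def lambertTerm (q : A) (n : ℕ) : A := q ^ n * (1 - q ^ n)⁻¹ʳ ^ 2

/-- The kernel `1 / ((q; q)_{n - r} (q; q)_{n + r})` of Bailey pairs relative to `1`; as usual it is
zero for `n < r`, where the natural subtraction `n - r` would be meaningless. -/
noncomputable def baileyKernel (q : A) (n r : ℕ) : A :=
  if r ≤ n then (qPochhammer q q (n - r))⁻¹ʳ * (qPochhammer q q (n + r))⁻¹ʳ else 0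

/-- `(α, β)` is a Bailey pair relative to `1` (in base `q`). -/
def IsBaileyPair (q : A) (α β : ℕ → A) : Prop :=
  ∀ n, β n = ∑ r ∈ range (n + 1), α r * baileyKernel q n r

/-- The sequence `1, -(q + q ^ 2), q ^ 5 + q ^ 7, …` of signed powers of `q` to the generalized
pentagonal numbers. It is the first half of a Bailey pair in base `q` and, placed on the even
indices, of one in base `q ^ (1 / 2)`. -/
def pentagonalAlpha (q : A) : ℕ → A
  | 0 => 1
  | r + 1 => (-1) ^ (r + 1) * (q ^ pentagonal (r + 1) + q ^ pentagonal (-(r + 1)))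

lemma qPochhammer_zero (a q : A) : qPochhammer a q 0 = 1 := prod_range_zero _

lemma qPochhammer_succ (a q : A) (n : ℕ) :
    qPochhammer a q (n + 1) = qPochhammer a q n * (1 - a * q ^ n) :=
  prod_range_succ _ _

lemma qPochhammer_self_succ (q : A) (n : ℕ) :
    qPochhammer q q (n + 1) = qPochhammer q q n * (1 - q ^ (n + 1)) := by
  rw [qPochhammer_succ, pow_succ']

lemma mul_pow_dvd_qPochhammer_sub (a q : A) {m n : ℕ} (h : m ≤ n) :
    a * q ^ m ∣ qPochhammer a q n - qPochhammer a q m := by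
  induction n, h using Nat.le_induction with
  | base => simp
  | succ n h ih =>
    have hstep : qPochhammer a q (n + 1) - qPochhammer a q m =
        qPochhammer a q n - qPochhammer a q m - a * q ^ n * qPochhammer a q n := by
      rw [qPochhammer_succ]
      ring
    rw [hstep]
    exact ih.sub ((mul_dvd_mul_left a (pow_dvd_pow q h)).mul_right _)

lemma pow_dvd_qPochhammer_self_sub (q : A) {m n : ℕ} (h : m ≤ n) :
    q ^ (m + 1) ∣ qPochhammer q q n - qPochhammer q q m := by
  rw [pow_succ']
  exact mul_pow_dvd_qPochhammer_sub q q h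

lemma qPochhammer_self_eq_mul_prod_Ioc (q : A) {s M : ℕ} (h : s ≤ M) :
    qPochhammer q q M = qPochhammer q q s * ∏ i ∈ Ioc s M, (1 - q ^ i) := by
  induction M, h using Nat.le_induction with
  | base => simp
  | succ M h ih => rw [qPochhammer_self_succ, ih, prod_Ioc_succ_top h, mul_assoc]

lemma qPochhammer_self_two_mul (q : A) (n : ℕ) :
    qPochhammer q q (2 * n) = qPochhammer (q ^ 2) (q ^ 2) n * qPochhammer q (q ^ 2) n := by
  induction n with
  | zero => simp [qPochhammer_zero]
  | succ n ih =>
    rw [show 2 * (n + 1) = 2 * n + 1 + 1 by ring, qPochhammer_self_succ, qPochhammer_self_succ, ih,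
      qPochhammer_self_succ, qPochhammer_succ q]
    ring

lemma qPochhammer_sq_self_mul_qPochhammer_sq (q : A) {s M : ℕ} (h : s ≤ M) :
    qPochhammer (q ^ 2) (q ^ 2) M * qPochhammer q (q ^ 2) s =
      qPochhammer q q s * ∏ i ∈ Ioc s (2 * M) with i ≤ 2 * s ∨ Even i, (1 - q ^ i) := by
  induction M, h using Nat.le_induction with
  | base =>
    rw [← qPochhammer_self_two_mul, filter_true_of_mem fun i hi ↦ .inl (mem_Ioc.1 hi).2,
      ← qPochhammer_self_eq_mul_prod_Ioc q (by omega)]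
  | succ M h ih =>
    have hodd : ¬(2 * M + 1 ≤ 2 * s ∨ Even (2 * M + 1)) := by grind
    rw [prod_filter] at ih ⊢
    rw [qPochhammer_self_succ, show 2 * (M + 1) = 2 * M + 1 + 1 by ring,
      prod_Ioc_succ_top (by omega), prod_Ioc_succ_top (by omega), if_neg hodd,
      if_pos (.inr ⟨M + 1, by ring⟩)]
    linear_combination (1 - (q ^ 2) ^ (M + 1)) * ih

lemma lambertTerm_sq (q : A) (n : ℕ) : lambertTerm (q ^ 2) n = lambertTerm q (2 * n) := by
  rw [lambertTerm, lambertTerm, pow_mul]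

lemma lambertTerm_mul {q : A} {n : ℕ} (h : IsUnit (1 - q ^ n)) :
    lambertTerm q n * (1 - q ^ n) ^ 2 = q ^ n := by
  rw [lambertTerm, mul_assoc, ← mul_pow, Ring.inverse_mul_cancel _ h, one_pow, mul_one]

lemma eq_lambertTerm_iff {q : A} {n : ℕ} (h : IsUnit (1 - q ^ n)) (x : A) :
    x = lambertTerm q n ↔ x * (1 - q ^ n) ^ 2 = q ^ n := by
  rw [← (h.pow 2).mul_left_inj, lambertTerm_mul h]

lemma map_lambertTerm {B : Type*} [CommRing B] (f : A →+* B) {q : A} {n : ℕ}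
    (h : IsUnit (1 - q ^ n)) : f (lambertTerm q n) = lambertTerm (f q) n := by
  have hf : IsUnit (1 - f q ^ n) := by simpa using h.map f
  rw [eq_lambertTerm_iff hf]
  simpa using congrArg f (lambertTerm_mul h)

lemma pentagonal_neg_natCast (r : ℕ) : pentagonal (-r) = pentagonal r + r := by
  have h₁ := two_mul_natCast_pentagonal r
  have h₂ := two_mul_natCast_pentagonal_neg r
  zify
  linarith

lemma pentagonal_natCast_succ (r : ℕ) :
    pentagonal (r + 1) = pentagonal r + (3 * r + 1) := by
  have h₁ := two_mul_natCast_pentagonal r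
  have h₂ := two_mul_natCast_pentagonal (r + 1)
  zify
  linarith

lemma pentagonalAlpha_succ (q : A) (r : ℕ) :
    pentagonalAlpha q (r + 1) =
      -((-1) ^ r * q ^ pentagonal r * q ^ (3 * r + 1) * (1 + q ^ (r + 1))) := by
  have hneg := pentagonal_neg_natCast (r + 1)
  have hsucc := pentagonal_natCast_succ r
  push_cast at hneg
  rw [pentagonalAlpha, hneg, hsucc]
  ring

lemma baileyKernel_of_lt (q : A) {n r : ℕ} (h : n < r) : baileyKernel q n r = 0 :=
  if_neg h.not_ge

lemma baileyKernel_add (q : A) (r k : ℕ) :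
    baileyKernel q (r + k) r =
      (qPochhammer q q k)⁻¹ʳ * (qPochhammer q q (2 * r + k))⁻¹ʳ := by
  rw [baileyKernel, if_pos (r.le_add_right k), Nat.add_sub_cancel_left, two_mul, add_right_comm]

lemma IsBaileyPair.eq_sum_of_le {q : A} {α β : ℕ → A} (h : IsBaileyPair q α β) {n N : ℕ}
    (hn : n ≤ N) : β n = ∑ r ∈ range (N + 1), α r * baileyKernel q n r := by
  rw [h n]
  refine sum_subset (range_subset_range.2 (by omega)) fun r _ hr ↦ ?_
  rw [baileyKernel_of_lt q (by simpa using hr), mul_zero]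

lemma IsBaileyPair.of_recurrence {q : A} {α β u : ℕ → A} (hu : ∀ n, IsUnit (u n))
    (hzero : β 0 = α 0) (hβ : ∀ n, u n * β (n + 1) = β n)
    (hα : ∀ n, ∑ r ∈ range (n + 2),
      α r * (u n * baileyKernel q (n + 1) r - baileyKernel q n r) = 0) :
    IsBaileyPair q α β := by
  intro n
  induction n with
  | zero => simp [hzero, baileyKernel, qPochhammer_zero]
  | succ n ih =>
    have h := hα n
    simp only [mul_sub, sum_sub_distrib, mul_left_comm _ (u n), ← mul_sum, sub_eq_zero] at h
    rw [← (hu n).mul_right_inj, hβ, ih, h, sum_range_succ _ (n + 1),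
      baileyKernel_of_lt q n.lt_succ_self, mul_zero, add_zero]

variable {q : A}

lemma IsRegularBase.sq (hq : IsRegularBase q) : IsRegularBase (q ^ 2) := fun k hk ↦ by
  rw [← pow_mul]
  exact hq _ (by omega)

lemma isUnit_qPochhammer_self (hq : IsRegularBase q) (n : ℕ) : IsUnit (qPochhammer q q n) :=
  IsUnit.prod_iff.2 fun i _ ↦ by simpa only [pow_succ'] using hq (i + 1) i.succ_ne_zero

lemma isUnit_one_sub_mul_sq_pow (hq : IsRegularBase q) (n : ℕ) : IsUnit (1 - q * (q ^ 2) ^ n) := by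
  rw [← pow_mul, ← pow_succ']
  exact hq _ (by omega)

lemma isUnit_qPochhammer_sq (hq : IsRegularBase q) (n : ℕ) : IsUnit (qPochhammer q (q ^ 2) n) :=
  IsUnit.prod_iff.2 fun i _ ↦ isUnit_one_sub_mul_sq_pow hq i

lemma inverse_qPochhammer_self_succ_mul (hq : IsRegularBase q) (n : ℕ) :
    (qPochhammer q q (n + 1))⁻¹ʳ * (1 - q ^ (n + 1)) = (qPochhammer q q n)⁻¹ʳ := by
  have hunit := hq (n + 1) n.succ_ne_zero
  rw [qPochhammer_self_succ, Ring.inverse_mul (.inr hunit), mul_right_comm,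
    Ring.inverse_mul_cancel _ hunit, one_mul]

lemma baileyKernel_succ_left (hq : IsRegularBase q) (n r : ℕ) :
    baileyKernel q n r =
      (1 - q ^ (n + 1 - r)) * (1 - q ^ (n + 1 + r)) * baileyKernel q (n + 1) r := by
  rcases lt_trichotomy (n + 1) r with h | rfl | h
  · rw [baileyKernel_of_lt q h, baileyKernel_of_lt q (n.lt_succ_self.trans h), mul_zero]
  · simp [baileyKernel_of_lt q n.lt_succ_self]
  · obtain ⟨k, rfl⟩ := Nat.exists_eq_add_of_le (Nat.lt_succ_iff.1 h)
    rw [show r + k + 1 - r = k + 1 by omega, show r + k + 1 + r = 2 * r + k + 1 by ring,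
      add_assoc r k 1, baileyKernel_add, baileyKernel_add,
      ← inverse_qPochhammer_self_succ_mul hq k,
      ← inverse_qPochhammer_self_succ_mul hq (2 * r + k), ← add_assoc (2 * r)]
    ring

lemma baileyKernel_succ_right (hq : IsRegularBase q) (n r : ℕ) :
    (1 - q ^ (n + r + 1)) * baileyKernel q n (r + 1) =
      (1 - q ^ (n - r)) * baileyKernel q n r := by
  rcases lt_trichotomy n r with h | rfl | h
  · rw [baileyKernel_of_lt q h, baileyKernel_of_lt q (h.trans r.lt_succ_self), mul_zero, mul_zero]
  · simp [baileyKernel_of_lt q n.lt_succ_self]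
  · obtain ⟨k, rfl⟩ := Nat.exists_eq_add_of_le (Nat.succ_le_of_lt h)
    rw [show r.succ + k - r = k + 1 by omega,
      show r.succ + k + r + 1 = 2 * r + (k + 1) + 1 by omega,
      baileyKernel_add, show r.succ + k = r + (k + 1) by omega, baileyKernel_add,
      ← inverse_qPochhammer_self_succ_mul hq k,
      ← inverse_qPochhammer_self_succ_mul hq (2 * r + (k + 1)),
      show 2 * (r + 1) + k = 2 * r + (k + 1) + 1 by ring]
    ring

/-- A terminating indefinite sum: both sides have the same first difference in `N`. -/
lemma sum_lambertTerm_mul_baileyKernel (hq : IsRegularBase q) {r : ℕ} (hr : r ≠ 0) (N : ℕ) :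
    ∑ n ∈ Icc 1 N, lambertTerm q n * qPochhammer q q n ^ 2 * baileyKernel q n r =
      lambertTerm q r * (qPochhammer q q N ^ 2 * baileyKernel q N r) := by
  induction N with
  | zero => simp [baileyKernel_of_lt q (Nat.pos_of_ne_zero hr)]
  | succ N ih =>
    rw [sum_Icc_succ_top (by omega), ih, baileyKernel_succ_left hq N r, qPochhammer_self_succ]
    rcases lt_or_ge (N + 1) r with h | h
    · simp [baileyKernel_of_lt q h]
    · obtain ⟨k, hk⟩ := Nat.exists_eq_add_of_le h
      have hlr := lambertTerm_mul (hq r hr)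
      have hlN := lambertTerm_mul (hq (N + 1) N.succ_ne_zero)
      rw [hk] at hlN ⊢
      rw [Nat.add_sub_cancel_left]
      linear_combination qPochhammer q q N ^ 2 * baileyKernel q (r + k) r *
        (hlN - q ^ k * hlr)

lemma pow_dvd_lambertTerm_mul_sub_one (hq : IsRegularBase q) (N r : ℕ) :
    q ^ (N + 1) ∣ lambertTerm q r * (qPochhammer q q N ^ 2 * baileyKernel q N r - 1) := by
  have hlambert : q ^ r ∣ lambertTerm q r := dvd_mul_right _ _
  rcases lt_or_ge N r with h | h
  · exact ((pow_dvd_pow q h).trans hlambert).mul_right _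
  · obtain ⟨k, rfl⟩ := Nat.exists_eq_add_of_le h
    have hlow := mul_dvd_mul hlambert (pow_dvd_qPochhammer_self_sub q (Nat.le_add_left k r))
    have hhigh := pow_dvd_qPochhammer_self_sub q (show r + k ≤ 2 * r + k by omega)
    rw [← pow_add, ← add_assoc] at hlow
    have hk := Ring.mul_inverse_cancel _ (isUnit_qPochhammer_self hq k)
    have hrk := Ring.mul_inverse_cancel _ (isUnit_qPochhammer_self hq (2 * r + k))
    set P := qPochhammer q q
    -- Here `baileyKernel q (r + k) r` is `1 / (P k * P (2 * r + k))`, and each of `P k` and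
    -- `P (2 * r + k)` is close to `P (r + k)`.
    have hdecomp : lambertTerm q r * (P (r + k) ^ 2 * baileyKernel q (r + k) r - 1) =
        lambertTerm q r * (P (r + k) - P k) * ((P k)⁻¹ʳ * (P (r + k) * (P (2 * r + k))⁻¹ʳ)) -
          (P (2 * r + k) - P (r + k)) * (lambertTerm q r * (P (2 * r + k))⁻¹ʳ) := by
      rw [baileyKernel_add]
      linear_combination lambertTerm q r * P (r + k) * (P (2 * r + k))⁻¹ʳ * hk +
        lambertTerm q r * hrk
    rw [hdecomp]
    exact (hlow.mul_right _).sub (hhigh.mul_right _)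

/-- Bailey's lemma relative to `1` with parameters `ρ₁, ρ₂`, truncated at `N` and differentiated in
both parameters at `ρ₁ = ρ₂ = 1`. -/
lemma IsBaileyPair.sum_lambertTerm_mul (hq : IsRegularBase q) {α β : ℕ → A}
    (h : IsBaileyPair q α β) (N : ℕ) :
    ∑ n ∈ Icc 1 N, lambertTerm q n * qPochhammer q q n ^ 2 * β n =
      α 0 * ∑ n ∈ Icc 1 N, lambertTerm q n +
        ∑ r ∈ Icc 1 N, α r * (lambertTerm q r * (qPochhammer q q N ^ 2 * baileyKernel q N r)) := by
  have hzero (n : ℕ) : qPochhammer q q n ^ 2 * baileyKernel q n 0 = 1 := by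
    have hn := Ring.mul_inverse_cancel _ (isUnit_qPochhammer_self hq n)
    rw [baileyKernel, if_pos n.zero_le, Nat.sub_zero, Nat.add_zero]
    linear_combination (qPochhammer q q n * (qPochhammer q q n)⁻¹ʳ + 1) * hn
  have hterm : ∀ n ∈ Icc 1 N, lambertTerm q n * qPochhammer q q n ^ 2 * β n =
      α 0 * lambertTerm q n + ∑ r ∈ Icc 1 N,
        α r * (lambertTerm q n * qPochhammer q q n ^ 2 * baileyKernel q n r) := fun n hn ↦ by
    rw [h.eq_sum_of_le (mem_Icc.1 hn).2, sum_range_succ_eq_add_sum_Icc, mul_add, mul_sum]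
    congr 1
    · linear_combination lambertTerm q n * α 0 * hzero n
    · exact sum_congr rfl fun r _ ↦ mul_left_comm _ _ _
  rw [sum_congr rfl hterm, sum_add_distrib, mul_sum, sum_comm]
  congr 1
  refine sum_congr rfl fun r hr ↦ ?_
  rw [← mul_sum, sum_lambertTerm_mul_baileyKernel hq (Nat.one_le_iff_ne_zero.1 (mem_Icc.1 hr).1)]

lemma IsBaileyPair.pow_dvd_sum_lambertTerm_mul_sub (hq : IsRegularBase q) {α β : ℕ → A}
    (h : IsBaileyPair q α β) (N : ℕ) :
    q ^ (N + 1) ∣ ∑ n ∈ Icc 1 N, lambertTerm q n * qPochhammer q q n ^ 2 * β n -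
      (α 0 * ∑ n ∈ Icc 1 N, lambertTerm q n + ∑ r ∈ Icc 1 N, α r * lambertTerm q r) := by
  rw [h.sum_lambertTerm_mul hq, add_sub_add_left_eq_sub, ← sum_sub_distrib]
  refine dvd_sum fun r _ ↦ ?_
  rw [← mul_sub, ← mul_sub_one]
  exact (pow_dvd_lambertTerm_mul_sub_one hq N r).mul_left _

lemma sum_pentagonalAlpha_mul_baileyKernel_sub (hq : IsRegularBase q) (n R : ℕ) :
    ∑ r ∈ range (R + 1), pentagonalAlpha q r *
        ((1 - q ^ (n + 1)) * baileyKernel q (n + 1) r - baileyKernel q n r) =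
      (-1) ^ R * q ^ pentagonal R * q ^ (n + 1 + 2 * R) *
        ((1 - q ^ (n + 1 - R)) * baileyKernel q (n + 1) R) := by
  induction R with
  | zero =>
    rw [zero_add, sum_range_one, baileyKernel_succ_left hq n 0,
      show pentagonal (0 : ℕ) = 0 from rfl]
    simp only [pentagonalAlpha, mul_zero, tsub_zero, add_zero]
    ring
  | succ R ih =>
    rw [sum_range_succ, ih, ← baileyKernel_succ_right hq (n + 1) R, pentagonalAlpha_succ,
      baileyKernel_succ_left hq n (R + 1), Nat.cast_succ, pentagonal_natCast_succ]
    rcases lt_or_ge n R with h | h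
    · rw [baileyKernel_of_lt q (Nat.succ_lt_succ h)]
      ring
    · obtain ⟨k, rfl⟩ := Nat.exists_eq_add_of_le h
      rw [show R + k + 1 - (R + 1) = k by omega]
      ring

lemma sum_pentagonalAlpha_sq_mul_baileyKernel_sub (hq : IsRegularBase q) (n R : ℕ) :
    ∑ r ∈ range (R + 1), pentagonalAlpha (q ^ 2) r *
        ((1 - q ^ (n + 1)) * (1 - q * (q ^ 2) ^ n) * baileyKernel q (n + 1) (2 * r) -
          baileyKernel q n (2 * r)) =
      (-1) ^ R * (q ^ 2) ^ pentagonal R * q ^ (n + 1 + 4 * R) *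
        ((1 - q ^ (n - 2 * R)) * ((1 - q ^ (n + 1 - 2 * R)) * baileyKernel q (n + 1) (2 * R))) := by
  have hshift (R : ℕ) : (1 - q ^ (n - 2 * R)) *
      ((1 - q ^ (n + 1 - 2 * R)) * baileyKernel q (n + 1) (2 * R)) =
      (1 - q ^ (n + 1 + 2 * R + 1)) * ((1 - q ^ (n + 1 + (2 * R + 1) + 1)) *
        baileyKernel q (n + 1) (2 * (R + 1))) := by
    have h := baileyKernel_succ_right hq (n + 1) (2 * R + 1)
    rw [Nat.add_sub_add_right] at h
    rw [mul_add_one, h, ← baileyKernel_succ_right hq (n + 1) (2 * R)]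
    ring
  induction R with
  | zero =>
    rw [zero_add, sum_range_one, baileyKernel_succ_left hq n (2 * 0), ← pow_mul,
      show pentagonal (0 : ℕ) = 0 from rfl]
    simp only [pentagonalAlpha, mul_zero, tsub_zero, add_zero]
    ring
  | succ R ih =>
    rw [sum_range_succ, ih, hshift R, pentagonalAlpha_succ,
      baileyKernel_succ_left hq n (2 * (R + 1)), Nat.cast_succ, pentagonal_natCast_succ]
    rcases lt_trichotomy (n + 1) (2 * (R + 1)) with h | h | h
    · rw [baileyKernel_of_lt q h]
      ring
    · obtain rfl : n = 2 * R + 1 := by omega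
      rw [← h, Nat.sub_self]
      ring
    · obtain ⟨k, rfl⟩ := Nat.exists_eq_add_of_le (Nat.lt_succ_iff.1 h)
      rw [Nat.add_sub_cancel_left, show 2 * (R + 1) + k + 1 - 2 * (R + 1) = k + 1 by omega]
      ring

lemma isBaileyPair_pentagonalAlpha (hq : IsRegularBase q) :
    IsBaileyPair q (pentagonalAlpha q) fun n ↦ (qPochhammer q q n)⁻¹ʳ := by
  refine .of_recurrence (u := fun n ↦ 1 - q ^ (n + 1)) (fun n ↦ hq _ n.succ_ne_zero)
    (by simp [qPochhammer_zero, pentagonalAlpha])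
    (fun n ↦ by rw [mul_comm, inverse_qPochhammer_self_succ_mul hq]) fun n ↦ ?_
  rw [sum_pentagonalAlpha_mul_baileyKernel_sub hq n (n + 1), Nat.sub_self, pow_zero, sub_self,
    zero_mul, mul_zero]

lemma isBaileyPair_extend_pentagonalAlpha_sq (hq : IsRegularBase q) :
    IsBaileyPair q (Function.extend (2 * ·) (pentagonalAlpha (q ^ 2)) 0)
      fun n ↦ (qPochhammer q q n * qPochhammer q (q ^ 2) n)⁻¹ʳ := by
  have hu (n : ℕ) : IsUnit ((1 - q ^ (n + 1)) * (1 - q * (q ^ 2) ^ n)) :=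
    (hq _ n.succ_ne_zero).mul (isUnit_one_sub_mul_sq_pow hq n)
  refine .of_recurrence hu ?_ (fun n ↦ ?_) fun n ↦ ?_
  · rw [extend_two_mul_zero]
    simp [qPochhammer_zero, pentagonalAlpha]
  · rw [qPochhammer_self_succ, qPochhammer_succ, mul_mul_mul_comm, Ring.inverse_mul (.inr (hu n)),
      Ring.mul_inverse_cancel_left _ _ (hu n)]
  · have hvanish : ∀ r ∈ range (2 * (n + 1) + 1), r ∉ range (n + 2) →
        Function.extend (2 * ·) (pentagonalAlpha (q ^ 2)) 0 r *
          ((1 - q ^ (n + 1)) * (1 - q * (q ^ 2) ^ n) * baileyKernel q (n + 1) r -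
            baileyKernel q n r) = 0 := fun r _ hr ↦ by
      rw [mem_range, not_lt] at hr
      rw [baileyKernel_of_lt q (show n + 1 < r by omega), baileyKernel_of_lt q (by omega),
        mul_zero, sub_zero, mul_zero]
    rw [sum_subset (range_subset_range.2 (by omega)) hvanish, sum_range_extend_two_mul,
      sum_pentagonalAlpha_sq_mul_baileyKernel_sub hq, baileyKernel_of_lt q (by omega)]
    simp only [mul_zero]

lemma pow_dvd_sum_lambertTerm_sub_sub (hq : IsRegularBase q) (N : ℕ) :
    q ^ (2 * N + 1) ∣
      ∑ n ∈ Icc 1 (2 * N), lambertTerm q n * qPochhammer q q n * (qPochhammer q (q ^ 2) n)⁻¹ʳ -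
        ∑ n ∈ Icc 1 N, lambertTerm (q ^ 2) n * qPochhammer (q ^ 2) (q ^ 2) n -
        ∑ k ∈ range N, lambertTerm q (2 * k + 1) := by
  have h₁ := (isBaileyPair_extend_pentagonalAlpha_sq hq).pow_dvd_sum_lambertTerm_mul_sub hq (2 * N)
  have h₂ := (isBaileyPair_pentagonalAlpha hq.sq).pow_dvd_sum_lambertTerm_mul_sub hq.sq N
  have hβ₁ (n : ℕ) : lambertTerm q n * qPochhammer q q n ^ 2 *
      (qPochhammer q q n * qPochhammer q (q ^ 2) n)⁻¹ʳ =
      lambertTerm q n * qPochhammer q q n * (qPochhammer q (q ^ 2) n)⁻¹ʳ := by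
    have hn := Ring.mul_inverse_cancel _ (isUnit_qPochhammer_self hq n)
    rw [Ring.inverse_mul (.inl (isUnit_qPochhammer_self hq n))]
    linear_combination
      lambertTerm q n * qPochhammer q q n * (qPochhammer q (q ^ 2) n)⁻¹ʳ * hn
  have hβ₂ (n : ℕ) : lambertTerm (q ^ 2) n * qPochhammer (q ^ 2) (q ^ 2) n ^ 2 *
      (qPochhammer (q ^ 2) (q ^ 2) n)⁻¹ʳ =
      lambertTerm (q ^ 2) n * qPochhammer (q ^ 2) (q ^ 2) n := by
    rw [sq (qPochhammer _ _ _), ← mul_assoc,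
      Ring.mul_inverse_cancel_right _ _ (isUnit_qPochhammer_self hq.sq n)]
  simp only [hβ₁, extend_two_mul_zero, sum_Icc_extend_two_mul] at h₁
  simp only [hβ₂] at h₂
  rw [← pow_mul] at h₂
  replace h₂ := (pow_dvd_pow q (show 2 * N + 1 ≤ 2 * (N + 1) by omega)).trans h₂
  convert h₁.sub h₂ using 1
  rw [sum_Icc_one_two_mul (lambertTerm q) N]
  simp only [lambertTerm_sq, pentagonalAlpha]
  ring

end QSeries

section GeneratingFunctions

open Finset PowerSeries
open scoped Ring

lemma isRegularBase_X (R : Type*) [CommRing R] : IsRegularBase (X : R⟦X⟧) := fun k hk ↦ by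
  rw [PowerSeries.isUnit_iff_constantCoeff]
  simp [hk]

section Topology

open scoped PowerSeries.WithPiTopology

variable {R : Type*} [CommRing R] [TopologicalSpace R] [DiscreteTopology R]

lemma genFun_eq_prod (f : ℕ → ℕ → R) {T : Finset ℕ} (hT : 0 ∉ T)
    (hf : ∀ i ∉ T, ∀ c, f i c = 0) :
    Nat.Partition.genFun f =
      ∏ i ∈ T, (1 + ∑' j, f i (j + 1) • (X : R⟦X⟧) ^ (i * (j + 1))) := by
  have hpos : ∀ i ∈ T, i - 1 + 1 = i := fun i hi ↦
    Nat.sub_add_cancel (Nat.pos_of_ne_zero fun h ↦ hT (h ▸ hi))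
  rw [(Nat.Partition.hasProd_genFun f).unique (hasProd_prod_of_ne_finset_one
    (s := T.image (· - 1)) fun b hb ↦ ?_), prod_image fun i hi j hj h ↦ ?_]
  · exact prod_congr rfl fun i hi ↦ by simp only [hpos i hi]
  · rw [← hpos i hi, ← hpos j hj]
    exact congrArg (· + 1) h
  · have hb' : b + 1 ∉ T := fun h ↦ hb (mem_image.2 ⟨b + 1, h, rfl⟩)
    simp [hf _ hb']

lemma one_add_tsum_X_pow_mul_one_sub {i : ℕ} (hi : i ≠ 0) :
    (1 + ∑' j : ℕ, (1 : R) • (X : R⟦X⟧) ^ (i * (j + 1))) * (1 - X ^ i) = 1 := by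
  have hconst : (X ^ i : R⟦X⟧).constantCoeff = 0 := by simp [hi]
  have hsum := WithPiTopology.summable_pow_of_constantCoeff_eq_zero hconst
  have h := WithPiTopology.tsum_pow_mul_one_sub_of_constantCoeff_eq_zero hconst
  rw [hsum.tsum_eq_zero_add] at h
  simpa [pow_mul] using h

lemma tsum_natCast_smul_X_pow {s : ℕ} (hs : s ≠ 0) :
    ∑' j : ℕ, ((j + 1 : ℕ) : R) • (X : R⟦X⟧) ^ (s * (j + 1)) = lambertTerm X s := by
  have hgeom := one_add_tsum_X_pow_mul_one_sub (R := R) hs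
  have hsum_one := Nat.Partition.summable_genFun_term' (fun _ _ ↦ (1 : R)) hs
  have hsum_cast := Nat.Partition.summable_genFun_term' (fun _ c ↦ (c : R)) hs
  have hshift : ∑' j : ℕ, ((j + 1 : ℕ) : R) • (X : R⟦X⟧) ^ (s * (j + 1)) =
      X ^ s + X ^ s * (∑' j : ℕ, ((j + 1 : ℕ) : R) • (X : R⟦X⟧) ^ (s * (j + 1)) +
        ∑' j : ℕ, (1 : R) • (X : R⟦X⟧) ^ (s * (j + 1))) := by
    conv_lhs => rw [hsum_cast.tsum_eq_zero_add]
    rw [← hsum_cast.tsum_add hsum_one, ← (hsum_cast.add hsum_one).tsum_mul_left]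
    congr 1
    · simp
    · refine tsum_congr fun j ↦ ?_
      rw [← add_smul, mul_smul_comm, ← pow_add]
      push_cast
      ring_nf
  rw [eq_lambertTerm_iff (isRegularBase_X R s hs)]
  linear_combination (1 - X ^ s) * hshift + X ^ s * hgeom

lemma genFun_update_mul_prod_one_sub {T : Finset ℕ} {s : ℕ} (hT : 0 ∉ T) (hs : s ∉ T)
    (hs₀ : s ≠ 0) (g : ℕ → R) :
    Nat.Partition.genFun (Function.update (fun i _ ↦ if i ∈ T then 1 else 0) s g) *
        ∏ i ∈ T, (1 - X ^ i) =
      1 + ∑' j, g (j + 1) • (X : R⟦X⟧) ^ (s * (j + 1)) := by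
  rw [genFun_eq_prod (T := insert s T) _ (by simp [hT, hs₀.symm]) fun i hi c ↦ ?_,
    prod_insert hs, Function.update_self, mul_assoc, ← prod_mul_distrib]
  · rw [prod_eq_one fun i hi ↦ ?_, mul_one]
    simp only [Function.update_of_ne (ne_of_mem_of_not_mem hi hs), if_pos hi]
    exact one_add_tsum_X_pow_mul_one_sub (ne_of_mem_of_not_mem hi hT)
  · rw [mem_insert, not_or] at hi
    rw [Function.update_of_ne hi.1, if_neg hi.2]

end Topology

variable (R : Type*) [CommRing R]

/-- The generating function of the partitions with smallest part `s` and all other parts in `T`,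
weighted by the number of occurrences of `s`. Partitions without the part `s` are not excluded
from the sum, but have weight zero. -/
noncomputable def smallestPartGenFun (T : Finset ℕ) (s : ℕ) : R⟦X⟧ :=
  PowerSeries.mk fun n ↦
    ∑ p : n.Partition with ∀ i ∈ p.parts, i ∈ insert s T, (p.parts.count s : R)

variable {R}

lemma coeff_genFun_update {T : Finset ℕ} {s : ℕ} (g : ℕ → R) (n : ℕ) :
    coeff n (Nat.Partition.genFun (Function.update (fun i _ ↦ if i ∈ T then 1 else 0) s g)) =
      ∑ p : n.Partition with ∀ i ∈ p.parts, i ∈ insert s T,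
        if s ∈ p.parts then g (p.parts.count s) else 1 := by
  rw [Nat.Partition.coeff_genFun, sum_filter]
  refine sum_congr rfl fun p _ ↦ ?_
  have hother (S : Finset ℕ) (hS : s ∉ S) :
      ∏ i ∈ S, Function.update (fun i _ ↦ if i ∈ T then (1 : R) else 0) s g i (p.parts.count i) =
        if ∀ i ∈ S, i ∈ T then 1 else 0 := by
    rw [← prod_boole]
    exact prod_congr rfl fun i hi ↦ by rw [Function.update_of_ne (ne_of_mem_of_not_mem hi hS)]
  simp only [Finsupp.prod, Multiset.toFinsupp_support, Multiset.toFinsupp_apply]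
  by_cases hs : s ∈ p.parts
  · rw [← mul_prod_erase _ _ (Multiset.mem_toFinset.2 hs), hother _ (notMem_erase _ _),
      Function.update_self, mul_boole, if_pos hs]
    refine if_congr (forall_congr' fun i ↦ ?_) rfl rfl
    rw [mem_erase, Multiset.mem_toFinset, mem_insert]
    tauto
  · rw [hother _ (by simpa using hs), if_neg hs]
    refine if_congr (forall_congr' fun i ↦ ?_) rfl rfl
    rw [Multiset.mem_toFinset, mem_insert]
    exact forall_congr' fun hi ↦ (or_iff_right (ne_of_mem_of_not_mem hi hs)).symm

lemma smallestPartGenFun_eq_sub (T : Finset ℕ) (s : ℕ) :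
    smallestPartGenFun R T s =
      Nat.Partition.genFun (Function.update (fun i _ ↦ if i ∈ T then 1 else 0) s (↑)) -
        Nat.Partition.genFun (Function.update (fun i _ ↦ if i ∈ T then 1 else 0) s 0) := by
  ext n
  rw [map_sub, coeff_genFun_update, coeff_genFun_update, ← sum_sub_distrib, smallestPartGenFun,
    coeff_mk]
  refine sum_congr rfl fun p _ ↦ ?_
  split_ifs with hs
  · rw [Pi.zero_apply, sub_zero]
  · rw [Multiset.count_eq_zero_of_notMem hs, Nat.cast_zero, sub_self]

open scoped PowerSeries.WithPiTopology in
lemma smallestPartGenFun_mul_prod_one_sub {T : Finset ℕ} {s : ℕ} (hT : 0 ∉ T) (hs : s ∉ T)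
    (hs₀ : s ≠ 0) : smallestPartGenFun R T s * ∏ i ∈ T, (1 - X ^ i) = lambertTerm X s := by
  let _ : TopologicalSpace R := ⊥
  have _ : DiscreteTopology R := ⟨rfl⟩
  rw [smallestPartGenFun_eq_sub, sub_mul, genFun_update_mul_prod_one_sub hT hs hs₀,
    genFun_update_mul_prod_one_sub hT hs hs₀, tsum_natCast_smul_X_pow hs₀]
  simp

lemma smallestPart_eq_iff {n : ℕ} (p : n.Partition) {s : ℕ} (hs : s ∈ p.parts) :
    smallestPart p = s ↔ ∀ i ∈ p.parts, s ≤ i := by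
  have hmem : smallestPart p ∈ p.parts := Nat.sInf_mem (s := {i | i ∈ p.parts}) ⟨s, hs⟩
  have hle : ∀ i ∈ p.parts, smallestPart p ≤ i := fun i hi ↦
    Nat.sInf_le (s := {i | i ∈ p.parts}) hi
  exact ⟨fun h ↦ h ▸ hle, fun h ↦ (hle s hs).antisymm (h _ hmem)⟩

open Classical in
lemma coeff_smallestPartGenFun {n : ℕ} {P : ℕ → Prop} {T : Finset ℕ} {s : ℕ}
    (hT : ∀ i ≤ n, i ∈ T ↔ s < i ∧ P i) (hP : P s) :
    coeff n (smallestPartGenFun R T s) =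
      ∑ p : n.Partition with smallestPart p = s ∧ ∀ i ∈ p.parts, P i,
        (smallestPartCount p : R) := by
  rw [smallestPartGenFun, coeff_mk, sum_filter, sum_filter]
  refine sum_congr rfl fun p _ ↦ ?_
  by_cases hs : s ∈ p.parts
  · have hiff : (∀ i ∈ p.parts, i ∈ insert s T) ↔ smallestPart p = s ∧ ∀ i ∈ p.parts, P i := by
      rw [smallestPart_eq_iff p hs, ← forall₂_and]
      refine forall₂_congr fun i hi ↦ ?_
      rw [mem_insert, hT i (Nat.Partition.le_of_mem_parts hi), le_iff_eq_or_lt, or_and_right,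
        eq_comm]
      exact or_congr_left (by grind)
    rw [if_congr hiff rfl rfl]
    exact ite_congr rfl (fun h ↦ by rw [smallestPartCount, h.1]) fun _ ↦ rfl
  · have hcount := Multiset.count_eq_zero_of_notMem hs
    rw [hcount, Nat.cast_zero, ite_self, eq_comm, ite_eq_right_iff]
    rintro ⟨rfl, -⟩
    rw [smallestPartCount, hcount, Nat.cast_zero]

open Classical in
lemma sum_smallestPartCount_eq_sum_coeff {n : ℕ} {P : ℕ → ℕ → Prop} {T : ℕ → Finset ℕ}
    (hT : ∀ s, ∀ i ≤ n, i ∈ T s ↔ s < i ∧ P s i) (hP : ∀ s, P s s) :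
    ((∑ p : n.Partition with ∀ i ∈ p.parts, P (smallestPart p) i, smallestPartCount p : ℕ) : R) =
      ∑ s ∈ Icc 1 n, coeff n (smallestPartGenFun R (T s) s) := by
  have hcoeff (s : ℕ) := coeff_smallestPartGenFun (R := R) (hT s) (hP s)
  simp only [hcoeff, sum_filter]
  rw [sum_comm, Nat.cast_sum]
  refine sum_congr rfl fun p _ ↦ ?_
  simp only [ite_and, sum_ite_eq]
  by_cases hs : smallestPart p ∈ Icc 1 n
  · rw [if_pos hs, Nat.cast_ite, Nat.cast_zero]
  · have hmem : smallestPart p ∉ p.parts := fun h ↦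
      hs (mem_Icc.2 ⟨p.parts_pos h, Nat.Partition.le_of_mem_parts h⟩)
    rw [if_neg hs, smallestPartCount, Multiset.count_eq_zero_of_notMem hmem, ite_self,
      Nat.cast_zero]

lemma natCast_spt {n M : ℕ} (h : n ≤ M) :
    (spt n : R) = ∑ s ∈ Icc 1 n, coeff n (smallestPartGenFun R (Ioc s M) s) := by
  rw [← sum_smallestPartCount_eq_sum_coeff (P := fun _ _ ↦ True) (fun s i hi ↦ ?_)
    fun _ ↦ trivial, spt]
  · simp
  · rw [mem_Ioc, and_true, and_iff_left (hi.trans h)]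

lemma natCast_sptOPlus {n M : ℕ} (h : n ≤ M) :
    (sptOPlus n : R) =
      ∑ s ∈ Icc 1 n, coeff n (smallestPartGenFun R {i ∈ Ioc s M | i ≤ 2 * s ∨ Even i} s) := by
  have hiff (p : n.Partition) : NoLargeOddParts p ↔
      ∀ i ∈ p.parts, i ≤ 2 * smallestPart p ∨ Even i := forall₂_congr fun i _ ↦ by
    rw [← Nat.not_odd_iff_even, not_lt, imp_iff_not_or, or_comm]
  rw [← sum_smallestPartCount_eq_sum_coeff (P := fun s i ↦ i ≤ 2 * s ∨ Even i) (fun s i hi ↦ ?_)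
    fun s ↦ .inl (by omega), sptOPlus]
  · simp only [hiff]
    congr!
  · rw [mem_filter, mem_Ioc, and_iff_left (hi.trans h)]

lemma smallestPartGenFun_Ioc_mul_qPochhammer {s M : ℕ} (hs : s ≠ 0) (h : s ≤ M) :
    smallestPartGenFun R (Ioc s M) s * qPochhammer X X M =
      lambertTerm X s * qPochhammer X X s := by
  rw [qPochhammer_self_eq_mul_prod_Ioc X h, mul_left_comm,
    smallestPartGenFun_mul_prod_one_sub (by simp) (by simp) hs, mul_comm]

lemma smallestPartGenFun_filter_Ioc_mul_qPochhammer {s M : ℕ} (hs : s ≠ 0) (h : s ≤ M) :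
    smallestPartGenFun R {i ∈ Ioc s (2 * M) | i ≤ 2 * s ∨ Even i} s *
        qPochhammer (X ^ 2) (X ^ 2) M =
      lambertTerm X s * qPochhammer X X s * (qPochhammer X (X ^ 2) s)⁻¹ʳ := by
  have hunit : IsUnit (qPochhammer X (X ^ 2) s : R⟦X⟧) :=
    isUnit_qPochhammer_sq (isRegularBase_X R) s
  rw [← hunit.mul_left_inj, Ring.inverse_mul_cancel_right _ _ hunit, mul_assoc,
    qPochhammer_sq_self_mul_qPochhammer_sq X h, mul_left_comm,
    smallestPartGenFun_mul_prod_one_sub (by simp) (by simp) hs, mul_comm]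

lemma expand_qPochhammer_X (p : ℕ) (hp : p ≠ 0) (n : ℕ) :
    expand p hp (qPochhammer X X n : R⟦X⟧) = qPochhammer (X ^ p) (X ^ p) n := by
  simp [qPochhammer, map_prod]

lemma X_pow_dvd_sub_expand_mul_qPochhammer_sub (n : ℕ) :
    X ^ (2 * n + 1) ∣
      (∑ s ∈ Icc 1 (2 * n),
          smallestPartGenFun R {i ∈ Ioc s (2 * (2 * n)) | i ≤ 2 * s ∨ Even i} s -
        expand 2 two_ne_zero (∑ s ∈ Icc 1 n, smallestPartGenFun R (Ioc s (2 * n)) s)) *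
          expand 2 two_ne_zero (qPochhammer X X (2 * n)) -
        ∑ k ∈ range n, lambertTerm X (2 * k + 1) := by
  have hX := isRegularBase_X R
  convert pow_dvd_sum_lambertTerm_sub_sub hX n using 2
  rw [sub_mul, ← map_mul, sum_mul, sum_mul, map_sum, expand_qPochhammer_X]
  congr 1 <;> refine sum_congr rfl fun s hs ↦ ?_ <;> rw [mem_Icc, Nat.one_le_iff_ne_zero] at hs
  · exact smallestPartGenFun_filter_Ioc_mul_qPochhammer hs.1 hs.2
  · rw [smallestPartGenFun_Ioc_mul_qPochhammer hs.1 (by omega), map_mul, expand_qPochhammer_X]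
    congr 1
    simpa using map_lambertTerm (expand 2 two_ne_zero : R⟦X⟧ →ₐ[R] R⟦X⟧).toRingHom (hX s hs.1)

end GeneratingFunctions

section Parity

open Finset PowerSeries
open scoped Ring

lemma sq_eq_expand_two (f : (ZMod 2)⟦X⟧) : f ^ 2 = expand 2 two_ne_zero f := by
  have h := MvPowerSeries.map_frobenius_expand (p := 2) two_ne_zero (f := f)
  rw [ZMod.frobenius_zmod, MvPowerSeries.map_id] at h
  exact h.symm

lemma coeff_expand_mul_lambertTerm_of_odd (f : (ZMod 2)⟦X⟧) {k : ℕ} (hk : Odd k) (n : ℕ) :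
    coeff (2 * n) (expand 2 two_ne_zero f * lambertTerm X k) = 0 := by
  rw [lambertTerm, sq_eq_expand_two, mul_left_comm, ← map_mul, coeff_X_pow_mul']
  split_ifs with h
  · refine coeff_expand_of_not_dvd 2 two_ne_zero _ ?_
    obtain ⟨j, rfl⟩ := hk
    omega
  · rfl

lemma coeff_eq_zero_of_X_pow_dvd {f g : (ZMod 2)⟦X⟧} (hg : IsUnit g) {n N : ℕ}
    (h : X ^ (2 * n + 1) ∣
      f * expand 2 two_ne_zero g - ∑ k ∈ range N, lambertTerm X (2 * k + 1)) :
    coeff (2 * n) f = 0 := by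
  have hinv : expand 2 two_ne_zero g * expand 2 two_ne_zero g⁻¹ʳ = 1 := by
    rw [← map_mul, Ring.mul_inverse_cancel g hg, map_one]
  have hcoeff := X_pow_dvd_iff.1 (h.mul_left (expand 2 two_ne_zero g⁻¹ʳ)) (2 * n) (by omega)
  rw [mul_sub, mul_left_comm, mul_comm (expand 2 _ _) (expand 2 _ _), hinv, mul_one, mul_sum,
    map_sub, map_sum, sum_eq_zero, sub_zero] at hcoeff
  · exact hcoeff
  · exact fun k _ ↦ coeff_expand_mul_lambertTerm_of_odd _ ⟨k, rfl⟩ n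

end Parity

theorem theorem3 (n : ℕ) : sptOPlus (2 * n) ≡ spt n [MOD 2] := by
  have hunit := isUnit_qPochhammer_self (isRegularBase_X (ZMod 2)) (2 * n)
  have hcoeff := coeff_eq_zero_of_X_pow_dvd hunit (X_pow_dvd_sub_expand_mul_qPochhammer_sub n)
  rw [← ZMod.natCast_eq_natCast_iff, natCast_sptOPlus (show 2 * n ≤ 2 * (2 * n) by omega),
    natCast_spt (show n ≤ 2 * n by omega), ← map_sum, ← map_sum]
  rwa [map_sub, PowerSeries.coeff_expand_mul, sub_eq_zero] at hcoeff
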